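/- Let $M$ be a collectible reward decomposition MDP with $n\ge 2$ rewards: a deterministic transition system in which each step takes one unit of time, with an initial state $s_0$ and $n$ distinct reward states $s_1,\dots,s_n$. The reward at $s_i$ has value $1$ and can be collected only once. Let $d(u,v)$ be the length of a shortest path from $u$ to $v$. Assume that every $s_j$ can be reached from $s_0$ and from every $s_i$, and that $d(s_i,s_j)=d(s_j,s_i)$ for all $i,j\ge 1$. For a discount factor $\gamma\in[0,1]$ (with $0^0=1$), the return of the tour that collects the rewards in the order $i_1,\dots,i_n$ is $$\sum_{j=0}^{n-1}\gamma^{\sum_{t=0}^{j} d(s_{i_t},s_{i_{t+1}})},\qquad i_0=0,$$ and $\mathrm{OPT}$ is the maximum of the return over all permutations $(i_1,\dots,i_n)$ of $\{1,\dots,n\}$. The policy NN starts at $s_0$ and always goes next to an uncollected reward nearest to its current position. The policy RA first goes from $s_0$ to a uniformly random reward $s_i$, and then collects the remaining rewards in increasing order of their distance from $s_i$. The policy NN-RA runs NN with probability $1/2$ and RA with probability $1/2$. Ties are broken arbitrarily. Write $\text{NN-RA}$ also for its expected return. **Theorem (NN-RA performance).** 1. For every $\alpha>0$ there is a constant $c>0$,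 depending only on $\alpha$, such that for all $n\ge2$, all such $M$, all $\gamma\in[0,1]$ and all ways of breaking ties, if $\mathrm{OPT}\ge\alpha n$ then $$\text{NN-RA}\;\ge\; c\,\frac{n^{-2/3}}{\log n}\,\mathrm{OPT}.$$ 2. There is an absolute constant $c>0$ such that for all $n\ge2$, all such $M$, all $\gamma\in[0,1]$ and all ways of breaking ties, $$\text{NN-RA}\;\ge\; c\,\frac{n^{-3/4}}{\log n}\,\mathrm{OPT}.$$ -/

import Mathlib

/-- A collectible reward decomposition MDP with `n` rewards: deterministic dynamics `step`,
initial state `start`, and `n` distinct reward states. Reward `i` equals `1` at the state `goal i`,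
equals `0` at every other state, and can be collected only once; the reward of the MDP is the sum
of these `n` rewards. -/
structure CollectibleMDP (n : ℕ) where
  /-- the states -/
  State : Type*
  /-- the primitive actions -/
  Action : Type*
  /-- the deterministic dynamics -/
  step : State → Action → State
  /-- the initial state `s₀` -/
  start : State
  /-- the states `s₁, …, sₙ` that carry the rewards -/
  goal : Fin n → State
  goal_injective : Function.Injective goal

namespace CollectibleMDP

variable {n : ℕ} (M : CollectibleMDP n)

/-- The action sequence `l`, executed from state `u`, ends in state `v`. -/
def Leads (u : M.State) (l : List M.Action) (v : M.State) : Prop :=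
  l.foldl M.step u = v

/-- The length of a shortest path from `u` to `v` (only used when there is a path). -/
noncomputable def dist (u v : M.State) : ℕ :=
  sInf {k : ℕ | ∃ l : List M.Action, l.length = k ∧ M.Leads u l v}

/-- There is an option for collecting each reward: every reward state can be reached from the
initial state and from every reward state. -/
def HasOptions : Prop :=
  (∀ j, ∃ l, M.Leads M.start l (M.goal j)) ∧ ∀ i j, ∃ l, M.Leads (M.goal i) l (M.goal j)

/-- The distances between rewards are symmetric. -/
def IsUndirected : Prop :=
  ∀ i j, M.dist (M.goal i) (M.goal j) = M.dist (M.goal j) (M.goal i)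

/-- The stops of the tour that collects the rewards in the order `σ 0, σ 1, …`: stop `0` is the
initial state, and stop `j + 1` is the state of the reward `σ j`. -/
def route (σ : Equiv.Perm (Fin n)) : Fin (n + 1) → M.State :=
  Fin.cons M.start fun j => M.goal (σ j)

/-- The time at which the tour `σ` collects the reward `σ j`. -/
noncomputable def arrival (σ : Equiv.Perm (Fin n)) (j : Fin n) : ℕ :=
  ∑ t ∈ Finset.Iic j, M.dist (M.route σ t.castSucc) (M.route σ t.succ)

/-- The discounted return of the tour `σ`. -/
noncomputable def tourReturn (γ : ℝ) (σ : Equiv.Perm (Fin n)) : ℝ :=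
  ∑ j : Fin n, γ ^ M.arrival σ j

/-- OPT: the largest discounted return of a tour. -/
noncomputable def opt (γ : ℝ) : ℝ :=
  Finset.univ.sup' Finset.univ_nonempty fun σ : Equiv.Perm (Fin n) => M.tourReturn γ σ

/-- `σ` is a run of NN from the initial state: the next reward is always one of the uncollected
rewards nearest to the current stop. (Ties are broken arbitrarily.) -/
def IsNNTour (σ : Equiv.Perm (Fin n)) : Prop :=
  ∀ j k : Fin n, j ≤ k →
    M.dist (M.route σ j.castSucc) (M.goal (σ j)) ≤ M.dist (M.route σ j.castSucc) (M.goal (σ k))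

/-- `σ` is a run of RA whose random first reward is `i`: it collects `i` first, and then the other
rewards in increasing order of their distance from `i`. (Ties are broken arbitrarily.) -/
def IsRATour (i : Fin n) (σ : Equiv.Perm (Fin n)) : Prop :=
  (∀ j : Fin n, (j : ℕ) = 0 → σ j = i) ∧
    Monotone fun j : Fin n => M.dist (M.goal i) (M.goal (σ j))

/-- The expected return of NN-RA when `nn` is the run of NN and `ra i` is the run of RA with first
reward `i`: with probability `1/2` the policy executes `nn`, and with probability `1/2` it executes
`ra i` for a uniformly random reward `i`. -/
noncomputable def nnraReturn (γ : ℝ) (nn : Equiv.Perm (Fin n))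
    (ra : Fin n → Equiv.Perm (Fin n)) : ℝ :=
  1 / 2 * M.tourReturn γ nn + 1 / 2 * ∑ i : Fin n, 1 / (n : ℝ) * M.tourReturn γ (ra i)

end CollectibleMDP

/-! ### Distances, arrival times, and the two policies -/

namespace CollectibleMDP

variable {n : ℕ} {M : CollectibleMDP n}

/-! On an optimal tour pick the position `p` for which `p * v` is largest, `v` being the discount
there; a harmonic sum gives OPT ≤ `p * v * (1 + log n)`. NN earns at least `v` from its first reward
alone. By maximality the second half of these `p` rewards is collected in a time window of some
length `W` over which the discount at most halves. Cut that window into about `√p` slices: rewards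
in a slice are within `W / √p` of each other, so RA started in a slice collects up to `√p` of them
with delay `O(W)`, which costs a constant factor. Averaging over the start, RA earns order `p * v *
√p / n` (`sum_tourReturn_ge_of_window`, `exists_tourReturn_le`). The larger of `1 / p` and `√p / n`
is at least `n ^ (-2 / 3)`, which yields both parts. -/

theorem dist_le_length {u v : M.State} {l : List M.Action} (h : M.Leads u l v) :
    M.dist u v ≤ l.length :=
  Nat.sInf_le ⟨l, rfl, h⟩

theorem exists_leads_length_eq_dist {u v : M.State} (h : ∃ l, M.Leads u l v) :
    ∃ l, l.length = M.dist u v ∧ M.Leads u l v := by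
  obtain ⟨l, hl⟩ := h
  exact Nat.sInf_mem (s := {k | ∃ l : List M.Action, l.length = k ∧ M.Leads u l v}) ⟨_, l, rfl, hl⟩

theorem dist_self (u : M.State) : M.dist u u = 0 :=
  Nat.le_zero.1 (dist_le_length (l := []) rfl)

theorem dist_triangle {u v w : M.State} (huv : ∃ l, M.Leads u l v) (hvw : ∃ l, M.Leads v l w) :
    M.dist u w ≤ M.dist u v + M.dist v w := by
  obtain ⟨l, hl, hl'⟩ := exists_leads_length_eq_dist huv
  obtain ⟨k, hk, hk'⟩ := exists_leads_length_eq_dist hvw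
  rw [← hl, ← hk, ← List.length_append]
  apply dist_le_length
  unfold Leads at *
  rw [List.foldl_append, hl', hk']

theorem arrival_zero (σ : Equiv.Perm (Fin n)) (h : 0 < n) :
    M.arrival σ ⟨0, h⟩ = M.dist M.start (M.goal (σ ⟨0, h⟩)) := by
  have : Finset.Iic (⟨0, h⟩ : Fin n) = {⟨0, h⟩} := by
    ext j
    simp [Fin.le_def, Fin.ext_iff]
  rw [arrival, this, Finset.sum_singleton]
  rfl

theorem arrival_succ (σ : Equiv.Perm (Fin n)) {t : ℕ} (h : t + 1 < n) :
    M.arrival σ ⟨t + 1, h⟩ = M.arrival σ ⟨t, by omega⟩ +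
      M.dist (M.goal (σ ⟨t, by omega⟩)) (M.goal (σ ⟨t + 1, h⟩)) := by
  have : Finset.Iic (⟨t + 1, h⟩ : Fin n) =
      insert ⟨t + 1, h⟩ (Finset.Iic (⟨t, by omega⟩ : Fin n)) := by
    ext j
    simp only [Finset.mem_Iic, Finset.mem_insert, Fin.le_def, Fin.ext_iff]
    omega
  rw [arrival, this, Finset.sum_insert (by simp [Fin.le_def]), add_comm]
  rfl

theorem arrival_mono (σ : Equiv.Perm (Fin n)) : Monotone (M.arrival σ) := fun _ _ h =>
  Finset.sum_le_sum_of_subset (Finset.Iic_subset_Iic.2 h)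

theorem dist_start_le_arrival (hM : M.HasOptions) (σ : Equiv.Perm (Fin n)) (j : Fin n) :
    M.dist M.start (M.goal (σ j)) ≤ M.arrival σ j := by
  obtain ⟨t, ht⟩ := j
  induction t with
  | zero => rw [arrival_zero]
  | succ t ih =>
    rw [arrival_succ]
    exact (dist_triangle (hM.1 _) (hM.2 (σ ⟨t, by omega⟩) _)).trans
      (Nat.add_le_add_right (ih (by omega)) _)

/-- Used to turn closeness in time on a tour into closeness in distance. -/
theorem arrival_add_dist_le (hM : M.HasOptions) (σ : Equiv.Perm (Fin n)) {j k : Fin n}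
    (hjk : j ≤ k) :
    M.arrival σ j + M.dist (M.goal (σ j)) (M.goal (σ k)) ≤ M.arrival σ k := by
  obtain ⟨t, ht⟩ := k
  induction t with
  | zero =>
    obtain rfl : j = ⟨0, ht⟩ := le_antisymm hjk (Fin.le_def.2 (Nat.zero_le _))
    rw [dist_self]
    rfl
  | succ t ih =>
    rcases hjk.eq_or_lt with rfl | h
    · rw [dist_self]
      rfl
    · have h1 := ih (by omega) (Fin.le_def.2 (Nat.lt_succ_iff.1 (Fin.lt_def.1 h)))
      have h2 := dist_triangle (hM.2 (σ j) (σ ⟨t, by omega⟩)) (hM.2 _ (σ ⟨t + 1, ht⟩))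
      rw [arrival_succ]
      omega

theorem tourReturn_nonneg {γ : ℝ} (hγ : 0 ≤ γ) (σ : Equiv.Perm (Fin n)) :
    0 ≤ M.tourReturn γ σ :=
  Finset.sum_nonneg fun _ _ => pow_nonneg hγ _

/-- The first reward of NN is the one nearest to the start, so no tour reaches any reward earlier.
-/
theorem pow_arrival_le_tourReturn_of_isNNTour (hM : M.HasOptions) {γ : ℝ} (hγ : 0 ≤ γ)
    (hγ1 : γ ≤ 1) {nn : Equiv.Perm (Fin n)} (hnn : M.IsNNTour nn) (σ : Equiv.Perm (Fin n))
    (j : Fin n) : γ ^ M.arrival σ j ≤ M.tourReturn γ nn := by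
  have hn : 0 < n := j.pos
  calc γ ^ M.arrival σ j ≤ γ ^ M.arrival nn ⟨0, hn⟩ := by
        apply pow_le_pow_of_le_one hγ hγ1
        have h := hnn ⟨0, hn⟩ (nn.symm (σ j)) (Fin.le_def.2 (Nat.zero_le _))
        rw [Equiv.apply_symm_apply] at h
        rw [arrival_zero]
        exact h.trans (dist_start_le_arrival hM σ j)
    _ ≤ _ := Finset.single_le_sum (f := fun j => γ ^ M.arrival nn j)
        (fun _ _ => pow_nonneg hγ _) (Finset.mem_univ _)

/-- If the set `T` of rewards is within distance `r` of the first reward of an RA tour, then so are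
the first `#T` rewards of the tour. -/
theorem dist_le_of_isRATour {i : Fin n} {σ : Equiv.Perm (Fin n)} (hσ : M.IsRATour i σ) {r : ℕ}
    {T : Finset (Fin n)} (hT : ∀ k ∈ T, M.dist (M.goal i) (M.goal k) ≤ r) {t : Fin n}
    (ht : (t : ℕ) < T.card) : M.dist (M.goal i) (M.goal (σ t)) ≤ r := by
  by_contra! hr
  -- A stop farther than `r` comes after all of `T` in the sorted order, but only `t` stops precede
  -- it.
  have hsub : T ⊆ (Finset.Iio t).map σ.toEmbedding := by
    intro k hk
    rw [Finset.mem_map_equiv, Finset.mem_Iio]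
    by_contra! h
    have h1 := hσ.2 h
    simp only [Equiv.apply_symm_apply] at h1
    have := hT k hk
    omega
  have := Finset.card_le_card hsub
  rw [Finset.card_map, Fin.card_Iio] at this
  omega

/-- Each leg is at most a detour through `i`, of length `2 * r` by symmetry. -/
theorem arrival_le_of_isRATour (hM : M.HasOptions) (hsymm : M.IsUndirected) {i : Fin n}
    {σ : Equiv.Perm (Fin n)} (hσ : M.IsRATour i σ) {r : ℕ} {T : Finset (Fin n)}
    (hT : ∀ k ∈ T, M.dist (M.goal i) (M.goal k) ≤ r) {t : Fin n} (ht : (t : ℕ) < T.card) :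
    M.arrival σ t ≤ M.dist M.start (M.goal i) + 2 * r * t := by
  obtain ⟨t, htn⟩ := t
  induction t with
  | zero => rw [arrival_zero, hσ.1 ⟨0, htn⟩ rfl]; simp
  | succ t ih =>
    simp only at ht
    have h0 := ih (by omega) (by simp only; omega)
    have h1 := dist_le_of_isRATour hσ hT (t := ⟨t, by omega⟩) (by simp only; omega)
    have h2 := dist_le_of_isRATour hσ hT (t := ⟨t + 1, htn⟩) ht
    have h3 := dist_triangle (hM.2 (σ ⟨t, by omega⟩) i) (hM.2 i (σ ⟨t + 1, htn⟩))
    rw [hsymm _ i] at h3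
    rw [arrival_succ]
    simp only [mul_add, mul_one] at h0 ⊢
    omega

/-- Counting at most `q` stops caps the delay at `2 * (q * r)`, however large `T` is. -/
theorem mul_pow_le_tourReturn_of_isRATour (hM : M.HasOptions) (hsymm : M.IsUndirected) {γ : ℝ}
    (hγ : 0 ≤ γ) (hγ1 : γ ≤ 1) {i : Fin n} {σ : Equiv.Perm (Fin n)} (hσ : M.IsRATour i σ) {r : ℕ}
    {T : Finset (Fin n)} (hT : ∀ k ∈ T, M.dist (M.goal i) (M.goal k) ≤ r) (q : ℕ) :
    (min T.card q : ℕ) * γ ^ (M.dist M.start (M.goal i) + 2 * (q * r)) ≤ M.tourReturn γ σ := by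
  have hn : T.card ≤ n := by simpa using T.card_le_univ
  have hcard : (Finset.univ.filter fun t : Fin n => (t : ℕ) < min T.card q).card =
      min T.card q := by
    rw [Fin.card_filter_val_lt]
    omega
  calc (min T.card q : ℕ) * γ ^ (M.dist M.start (M.goal i) + 2 * (q * r))
      = ∑ t ∈ Finset.univ.filter fun t : Fin n => (t : ℕ) < min T.card q,
          γ ^ (M.dist M.start (M.goal i) + 2 * (q * r)) := by
        rw [Finset.sum_const, hcard, nsmul_eq_mul]
    _ ≤ ∑ t ∈ Finset.univ.filter fun t : Fin n => (t : ℕ) < min T.card q, γ ^ M.arrival σ t := by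
        refine Finset.sum_le_sum fun t ht => pow_le_pow_of_le_one hγ hγ1 ?_
        have ht' := (Finset.mem_filter.1 ht).2
        have h1 := arrival_le_of_isRATour hM hsymm hσ hT (t := t) (by omega)
        have h2 : r * t ≤ r * q := Nat.mul_le_mul_left _ (by omega)
        rw [mul_assoc] at h1
        rw [mul_comm q r]
        omega
    _ ≤ _ := Finset.sum_le_sum_of_subset_of_nonneg (Finset.filter_subset _ _)
        fun _ _ _ => pow_nonneg hγ _

end CollectibleMDP

/-! ### Averaging over buckets -/

/-- If the elements of a finite set are distributed over `q + 1` buckets, then the truncated size of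
the bucket of an element is on average at least of the order `#s / q`. -/
theorem Finset.sum_min_card_fiber_ge {ι : Type*} (s : Finset ι) (f : ι → ℕ) (q : ℕ)
    (hf : ∀ i ∈ s, f i ≤ q) (hq : s.card ≤ 2 * q * (q + 1)) :
    (s.card : ℝ) ^ 2 / (4 * (q + 1)) ≤
      ∑ i ∈ s, ((min (s.filter fun k => f k = f i).card q : ℕ) : ℝ) := by
  have hmaps : ∀ i ∈ s, f i ∈ Finset.range (q + 1) := fun i hi =>
    Finset.mem_range.2 (Nat.lt_succ_of_le (hf i hi))
  have hq0 : (0 : ℝ) < q + 1 := by positivity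
  -- Half the average bucket size. A bucket of size `k` contributes `k * min k q ≥ t * (k - t)`,
  -- since `t ≤ q`; the right side is nonpositive when `k ≤ t`.
  set t : ℝ := s.card / (2 * (q + 1)) with ht
  have ht0 : 0 ≤ t := by positivity
  have htq : t ≤ q := by
    rw [ht, div_le_iff₀ (by positivity)]
    have : (s.card : ℝ) ≤ 2 * q * (q + 1) := by exact_mod_cast hq
    linarith
  have hcard : (s.card : ℝ) =
      ∑ b ∈ Finset.range (q + 1), ((s.filter fun k => f k = b).card : ℝ) := by
    exact_mod_cast Finset.card_eq_sum_card_fiberwise hmaps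
  calc (s.card : ℝ) ^ 2 / (4 * (q + 1))
      = t * (s.card - (q + 1) * t) := by
        rw [ht]
        field_simp
        ring
    _ = ∑ b ∈ Finset.range (q + 1), t * ((s.filter fun k => f k = b).card - t) := by
        rw [← Finset.mul_sum, Finset.sum_sub_distrib, ← hcard]
        simp
    _ ≤ ∑ b ∈ Finset.range (q + 1), ∑ i ∈ s with f i = b,
          ((min (s.filter fun k => f k = f i).card q : ℕ) : ℝ) := by
        refine Finset.sum_le_sum fun b _ => ?_
        rw [Finset.sum_congr rfl (g := fun _ =>
            ((min (s.filter fun k => f k = b).card q : ℕ) : ℝ))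
            fun i hi => by rw [(Finset.mem_filter.1 hi).2],
          Finset.sum_const, nsmul_eq_mul, Nat.cast_min]
        set k : ℝ := ((s.filter fun k => f k = b).card : ℝ)
        have hk : 0 ≤ k := Nat.cast_nonneg _
        rcases le_total t k with h | h
        · have := mul_le_mul_of_nonneg_left (le_min h htq) hk
          nlinarith
        · have : 0 ≤ k * min k q := mul_nonneg hk (le_min hk (Nat.cast_nonneg _))
          nlinarith
    _ = _ := Finset.sum_fiberwise_of_maps_to hmaps _

/-! ### RA on a time window, and the final balance -/

namespace CollectibleMDP

variable {n : ℕ} {M : CollectibleMDP n}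

/-- If a tour collects the rewards with indices in `s` during a window of length `W`, then
the runs of RA that start at these rewards have a large total return. -/
theorem sum_tourReturn_ge_of_window (hM : M.HasOptions) (hsymm : M.IsUndirected) {γ : ℝ}
    (hγ : 0 ≤ γ) (hγ1 : γ ≤ 1) {ra : Fin n → Equiv.Perm (Fin n)} (hra : ∀ i, M.IsRATour i (ra i))
    (σ : Equiv.Perm (Fin n)) {s : Finset (Fin n)} (hs : s.Nonempty) {a W : ℕ}
    (ha : ∀ j ∈ s, a ≤ M.arrival σ j) (hW : ∀ j ∈ s, M.arrival σ j ≤ a + W) :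
    (s.card : ℝ) * √s.card / 8 * γ ^ (a + 3 * W) ≤ ∑ i, M.tourReturn γ (ra i) := by
  set q := Nat.sqrt s.card with hq
  have hq1 : 1 ≤ q := Nat.sqrt_pos.2 hs.card_pos
  -- The time slice of a reward; the right endpoint gets the extra index `q`. If `W = 0`, division
  -- by zero puts everything in slice `0`.
  set f : Fin n → ℕ := fun j => (M.arrival σ j - a) * q / W with hf
  have hfq : ∀ j ∈ s, f j ≤ q := fun j hj => by
    apply Nat.div_le_of_le_mul
    apply Nat.mul_le_mul_right
    have := hW j hj
    omega
  have hlt : s.card < (q + 1) * (q + 1) := Nat.lt_succ_sqrt _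
  have hsum := Finset.sum_min_card_fiber_ge s f q hfq (by nlinarith)
  have hclose : ∀ j ∈ s, ∀ k ∈ s, f k = f j → j ≤ k →
      M.dist (M.goal (σ j)) (M.goal (σ k)) ≤ W / q := by
    intro j hj k hk hkj hle
    rw [Nat.le_div_iff_mul_le hq1]
    have h1 := arrival_add_dist_le hM σ hle
    obtain ⟨x, hx⟩ := Nat.exists_eq_add_of_le (ha j hj)
    obtain ⟨y, hy⟩ := Nat.exists_eq_add_of_le (ha k hk)
    have h2 := hW k hk
    simp only [hf, hx, hy, Nat.add_sub_cancel_left] at hkj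
    have h3 : M.dist (M.goal (σ j)) (M.goal (σ k)) * q + x * q ≤ y * q := by
      rw [← add_mul]
      apply Nat.mul_le_mul_right
      omega
    rcases Nat.eq_zero_or_pos W with rfl | hW0
    · have : M.dist (M.goal (σ j)) (M.goal (σ k)) = 0 := by omega
      simp [this]
    · have h4 := Nat.div_add_mod (x * q) W
      have h5 := Nat.div_add_mod (y * q) W
      have h6 := Nat.mod_lt (y * q) hW0
      rw [hkj] at h5
      omega
  have hstep : ∀ j ∈ s, ((min (s.filter fun k => f k = f j).card q : ℕ) : ℝ) *
      γ ^ (a + 3 * W) ≤ M.tourReturn γ (ra (σ j)) := by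
    intro j hj
    have hT : ∀ k ∈ (s.filter fun k => f k = f j).map σ.toEmbedding,
        M.dist (M.goal (σ j)) (M.goal k) ≤ W / q := by
      intro k hk
      obtain ⟨k, hk', rfl⟩ := Finset.mem_map.1 hk
      obtain ⟨hks, hkj⟩ := Finset.mem_filter.1 hk'
      rcases le_total j k with h | h
      · exact hclose j hj k hks hkj h
      · rw [hsymm]
        exact hclose k hks j hj hkj.symm h
    refine le_trans ?_ (mul_pow_le_tourReturn_of_isRATour hM hsymm hγ hγ1 (hra (σ j)) hT q)
    rw [Finset.card_map]
    refine mul_le_mul_of_nonneg_left (pow_le_pow_of_le_one hγ hγ1 ?_) (Nat.cast_nonneg _)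
    -- Reaching the first reward takes at most `a + W`, the later legs at most `2 * W`.
    have h1 := Nat.mul_div_le W q
    have h2 := dist_start_le_arrival hM σ j
    have h3 := hW j hj
    omega
  have hsq : (s.card : ℝ) * √s.card / 8 ≤ (s.card : ℝ) ^ 2 / (4 * (q + 1)) := by
    have h1 : (q : ℝ) ≤ √s.card := Real.nat_sqrt_le_real_sqrt
    have h2 : 1 ≤ √(s.card : ℝ) := by
      rw [Real.one_le_sqrt]
      exact_mod_cast hs.card_pos
    have h3 : √(s.card : ℝ) * √s.card = s.card := Real.mul_self_sqrt (Nat.cast_nonneg _)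
    rw [div_le_div_iff₀ (by norm_num) (by positivity)]
    calc (s.card : ℝ) * √s.card * (4 * (q + 1))
        ≤ s.card * √s.card * (4 * (√s.card + √s.card)) := by gcongr
      _ = 8 * s.card * (√s.card * √s.card) := by ring
      _ = _ := by rw [h3]; ring
  calc (s.card : ℝ) * √s.card / 8 * γ ^ (a + 3 * W)
      ≤ (∑ j ∈ s, ((min (s.filter fun k => f k = f j).card q : ℕ) : ℝ)) * γ ^ (a + 3 * W) :=
        mul_le_mul_of_nonneg_right (hsq.trans hsum) (pow_nonneg hγ _)
    _ ≤ ∑ j ∈ s, M.tourReturn γ (ra (σ j)) := by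
        rw [Finset.sum_mul]
        exact Finset.sum_le_sum hstep
    _ ≤ ∑ j, M.tourReturn γ (ra (σ j)) :=
        Finset.sum_le_univ_sum_of_nonneg fun _ => tourReturn_nonneg hγ _
    _ = _ := Equiv.sum_comp σ fun i => M.tourReturn γ (ra i)

/-- Some `p = j + 1 ≤ n` satisfies: `p` times the discount of the `p`-th reward on a tour is the return of
the tour up to a logarithm, and RA collects at least `√p / n` times that return on average. -/
theorem exists_tourReturn_le (hM : M.HasOptions) (hsymm : M.IsUndirected) (hn : 2 ≤ n)
    {γ : ℝ} (hγ : 0 ≤ γ) (hγ1 : γ ≤ 1) {ra : Fin n → Equiv.Perm (Fin n)}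
    (hra : ∀ i, M.IsRATour i (ra i)) (σ : Equiv.Perm (Fin n)) :
    ∃ j : Fin n, M.tourReturn γ σ ≤ ((j + 1 : ℕ) : ℝ) * γ ^ M.arrival σ j * (1 + Real.log n) ∧
      ((j + 1 : ℕ) : ℝ) * γ ^ M.arrival σ j * √((j + 1 : ℕ) : ℝ) / 128 ≤
        ∑ i, M.tourReturn γ (ra i) := by
  obtain ⟨m, -, hm⟩ := Finset.exists_max_image Finset.univ
    (fun j : Fin n => ((j + 1 : ℕ) : ℝ) * γ ^ M.arrival σ j) ⟨⟨0, by omega⟩, Finset.mem_univ _⟩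
  refine ⟨m, ?_, ?_⟩
  · set B := ((m + 1 : ℕ) : ℝ) * γ ^ M.arrival σ m
    have hB : 0 ≤ B := by positivity
    calc M.tourReturn γ σ ≤ ∑ j : Fin n, B * ((j : ℕ) + 1 : ℝ)⁻¹ := by
          refine Finset.sum_le_sum fun j _ => ?_
          have := hm j (Finset.mem_univ _)
          rw [← div_eq_mul_inv, le_div_iff₀ (by positivity), mul_comm]
          push_cast at this
          exact this
      _ = B * (harmonic n : ℝ) := by
          rw [← Finset.mul_sum, Fin.sum_univ_eq_sum_range fun j : ℕ => ((j : ℝ) + 1)⁻¹]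
          simp [harmonic]
      _ ≤ B * (1 + Real.log n) :=
          mul_le_mul_of_nonneg_left (harmonic_le_one_add_log n) hB
  · have hmn := m.isLt
    set h : Fin n := ⟨((m : ℕ) + 1) / 2, by omega⟩ with hh
    have hhm : h ≤ m := by
      rw [Fin.le_def]
      by_cases h0 : (m : ℕ) = 0
      · simp [hh, h0]
      · simp only [hh]
        omega
    have hmono := arrival_mono (M := M) σ
    obtain ⟨W, hW⟩ := Nat.exists_eq_add_of_le (hmono hhm)
    have hmax := hm h (Finset.mem_univ _)
    have hhalf : ((m + 1 : ℕ) : ℝ) ≤ 2 * ((h + 1 : ℕ) : ℝ) := by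
      have : (m : ℕ) + 1 ≤ 2 * ((h : ℕ) + 1) := by
        simp only [hh]
        omega
      exact_mod_cast this
    have hv : γ ^ M.arrival σ h ≤ 2 * γ ^ M.arrival σ m := by
      have h1 : 0 ≤ γ ^ M.arrival σ m := pow_nonneg hγ _
      have h2 : (0 : ℝ) < ((h + 1 : ℕ) : ℝ) := by positivity
      have h3 := mul_le_mul_of_nonneg_right hhalf h1
      refine le_of_mul_le_mul_left ?_ h2
      linarith
    -- Unless the discount at `h` vanishes, `hv` says `γ ^ W ≥ 1 / 2`, so two further factors `γ ^
    -- W` cost at most `4`.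
    have hpow : γ ^ M.arrival σ m / 4 ≤ γ ^ (M.arrival σ h + 3 * W) := by
      rw [hW] at hv ⊢
      have h0 : 0 ≤ γ ^ M.arrival σ h := pow_nonneg hγ _
      have hW0 : 0 ≤ γ ^ W := pow_nonneg hγ _
      rw [pow_add] at hv
      rw [pow_add, pow_add, mul_comm 3 W, pow_mul]
      rcases h0.eq_or_lt with h0 | h0
      · simp [← h0]
      · have hW2 : 1 / 2 ≤ γ ^ W := by
          by_contra! hlt
          nlinarith
        have : γ ^ W / 4 ≤ (γ ^ W) ^ 3 := by nlinarith [mul_le_mul hW2 hW2 (by norm_num) hW0]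
        nlinarith
    have hcard : ((m + 1 : ℕ) : ℝ) ≤ 2 * ((Finset.Icc h m).card : ℝ) := by
      have : (m : ℕ) + 1 ≤ 2 * (Finset.Icc h m).card := by
        rw [Fin.card_Icc]
        simp only [hh]
        omega
      exact_mod_cast this
    have hwin := sum_tourReturn_ge_of_window hM hsymm hγ hγ1 hra σ (s := Finset.Icc h m)
      (Finset.nonempty_Icc.2 hhm) (fun j hj => hmono (Finset.mem_Icc.1 hj).1)
      (fun j hj => (hmono (Finset.mem_Icc.1 hj).2).trans hW.le)
    refine le_trans ?_ hwin
    set p : ℝ := ((m + 1 : ℕ) : ℝ)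
    set k : ℝ := ((Finset.Icc h m).card : ℝ)
    have hp : 0 ≤ p := Nat.cast_nonneg _
    have hsqrt : √p / 2 ≤ √k := by
      apply Real.le_sqrt_of_sq_le
      rw [div_pow, Real.sq_sqrt hp]
      linarith
    calc p * γ ^ M.arrival σ m * √p / 128
        = (p / 2) * (√p / 2) / 8 * (γ ^ M.arrival σ m / 4) := by ring
      _ ≤ _ := by
        gcongr
        linarith

/-- The return of NN-RA is at least of the order `n ^ (-2 / 3) / log n` times OPT. -/
theorem nnraReturn_ge (hn : 2 ≤ n) (hM : M.HasOptions) (hsymm : M.IsUndirected) {γ : ℝ}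
    (hγ : 0 ≤ γ) (hγ1 : γ ≤ 1) {nn : Equiv.Perm (Fin n)} {ra : Fin n → Equiv.Perm (Fin n)}
    (hnn : M.IsNNTour nn) (hra : ∀ i, M.IsRATour i (ra i)) :
    1 / 1000 * (M.opt γ * (n : ℝ) ^ (-(2 / 3) : ℝ) / Real.log n) ≤ M.nnraReturn γ nn ra := by
  obtain ⟨σ, -, hσ⟩ := Finset.exists_mem_eq_sup' Finset.univ_nonempty
    fun σ : Equiv.Perm (Fin n) => M.tourReturn γ σ
  obtain ⟨j, hj, hjra⟩ := exists_tourReturn_le hM hsymm hn hγ hγ1 hra σ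
  have hjnn := pow_arrival_le_tourReturn_of_isNNTour hM hγ hγ1 hnn σ j
  change M.opt γ = _ at hσ
  rw [← hσ] at hj
  have hp : (0 : ℝ) < ((j + 1 : ℕ) : ℝ) := by positivity
  have hv : 0 ≤ γ ^ M.arrival σ j := pow_nonneg hγ _
  set p : ℝ := ((j + 1 : ℕ) : ℝ)
  set v : ℝ := γ ^ M.arrival σ j
  have hn0 : (0 : ℝ) < n := by exact_mod_cast (by omega : 0 < n)
  have hlog : 1 / 2 ≤ Real.log n := by
    have h1 : Real.log 2 ≤ Real.log n :=
      Real.log_le_log (by norm_num) (by exact_mod_cast hn)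
    linarith [Real.log_two_gt_d9]
  have hopt : M.opt γ / Real.log n ≤ 3 * (p * v) := by
    rw [div_le_iff₀ (by linarith)]
    have : 0 ≤ p * v := by positivity
    nlinarith
  -- The bounds `v` and `p * v * √p / n` balance at `p = y ^ 2`: NN serves smaller `p`, RA larger.
  set y : ℝ := (n : ℝ) ^ (1 / 3 : ℝ) with hy
  have hy0 : 0 < y := Real.rpow_pos_of_pos hn0 _
  have hy3 : (n : ℝ) = y ^ 3 := by
    rw [hy, ← Real.rpow_mul_natCast hn0.le]
    norm_num
  have hy2 : (n : ℝ) ^ (-(2 / 3) : ℝ) = (y ^ 2)⁻¹ := by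
    rw [hy, ← Real.rpow_mul_natCast hn0.le, Real.rpow_neg hn0.le]
    norm_num
  have hlhs : 1 / 1000 * (M.opt γ * (n : ℝ) ^ (-(2 / 3) : ℝ) / Real.log n) ≤
      p * v / (256 * y ^ 2) := by
    calc 1 / 1000 * (M.opt γ * (n : ℝ) ^ (-(2 / 3) : ℝ) / Real.log n)
        = 1 / 1000 * (y ^ 2)⁻¹ * (M.opt γ / Real.log n) := by rw [hy2]; ring
      _ ≤ 1 / 1000 * (y ^ 2)⁻¹ * (3 * (p * v)) := by gcongr
      _ = 3 / 1000 * (p * v / y ^ 2) := by ring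
      _ ≤ 1 / 256 * (p * v / y ^ 2) :=
        mul_le_mul_of_nonneg_right (by norm_num) (by positivity)
      _ = _ := by ring
  refine hlhs.trans ?_
  have hra0 : 0 ≤ ∑ i, M.tourReturn γ (ra i) :=
    Finset.sum_nonneg fun _ _ => tourReturn_nonneg hγ _
  rw [nnraReturn, ← Finset.mul_sum]
  generalize ∑ i, M.tourReturn γ (ra i) = S at *
  generalize M.tourReturn γ nn = N at *
  clear_value p v
  rcases le_total p (y ^ 2) with h | h
  · have h1 : p * v / (256 * y ^ 2) ≤ 1 / 2 * v := by
      rw [div_le_iff₀ (by positivity)]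
      have := mul_le_mul_of_nonneg_right h hv
      nlinarith [mul_nonneg (sq_nonneg y) hv]
    have h2 : 0 ≤ 1 / 2 * (1 / (n : ℝ) * S) := by positivity
    linarith
  · have h1 : y ≤ √p := Real.le_sqrt_of_sq_le h
    have h2 : p * v / (256 * y ^ 2) ≤ 1 / 2 * (1 / (n : ℝ) * (p * v * √p / 128)) := by
      calc p * v / (256 * y ^ 2) = 1 / 2 * (1 / (n : ℝ) * (p * v * y / 128)) := by
            rw [hy3]
            field_simp
            ring
        _ ≤ _ := by gcongr
    have h3 : 1 / 2 * (1 / (n : ℝ) * (p * v * √p / 128)) ≤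
        1 / 2 * (1 / (n : ℝ) * S) := by gcongr
    linarith

end CollectibleMDP

theorem mainTheorem5 :
    (∀ α : ℝ, 0 < α → ∃ c : ℝ, 0 < c ∧
      ∀ (n : ℕ) (M : CollectibleMDP n) (γ : ℝ) (nn : Equiv.Perm (Fin n))
        (ra : Fin n → Equiv.Perm (Fin n)),
        2 ≤ n → 0 ≤ γ → γ ≤ 1 → M.HasOptions → M.IsUndirected →
        M.IsNNTour nn → (∀ i, M.IsRATour i (ra i)) →
        α * (n : ℝ) ≤ M.opt γ →
        c * (M.opt γ * (n : ℝ) ^ (-(2 / 3) : ℝ) / Real.log n) ≤ M.nnraReturn γ nn ra) ∧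
    (∃ c : ℝ, 0 < c ∧
      ∀ (n : ℕ) (M : CollectibleMDP n) (γ : ℝ) (nn : Equiv.Perm (Fin n))
        (ra : Fin n → Equiv.Perm (Fin n)),
        2 ≤ n → 0 ≤ γ → γ ≤ 1 → M.HasOptions → M.IsUndirected →
        M.IsNNTour nn → (∀ i, M.IsRATour i (ra i)) →
        c * (M.opt γ * (n : ℝ) ^ (-(3 / 4) : ℝ) / Real.log n) ≤ M.nnraReturn γ nn ra) := by
  refine ⟨fun _ _ => ⟨1 / 1000, by norm_num, ?_⟩, 1 / 1000, by norm_num, ?_⟩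
  · intro n M γ nn ra hn hγ hγ1 hM hsymm hnn hra _
    exact CollectibleMDP.nnraReturn_ge hn hM hsymm hγ hγ1 hnn hra
  · intro n M γ nn ra hn hγ hγ1 hM hsymm hnn hra
    refine le_trans ?_ (CollectibleMDP.nnraReturn_ge hn hM hsymm hγ hγ1 hnn hra)
    have hn1 : (1 : ℝ) ≤ n := by exact_mod_cast (by omega : 1 ≤ n)
    have hopt : 0 ≤ M.opt γ := (CollectibleMDP.tourReturn_nonneg hγ nn).trans
      (Finset.le_sup' (fun σ => M.tourReturn γ σ) (Finset.mem_univ nn))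
    have hlog : 0 ≤ Real.log n := Real.log_nonneg hn1
    have hpow : (n : ℝ) ^ (-(3 / 4) : ℝ) ≤ (n : ℝ) ^ (-(2 / 3) : ℝ) :=
      Real.rpow_le_rpow_of_exponent_le hn1 (by norm_num)
    gcongr
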